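/- Let $\mathbb D=\{z\in\mathbb C:|z|<1\}$, and let $\mathcal S$ be the class of analytic univalent functions $f(z)=z+\sum_{n\ge 2}a_nz^n$ on $\mathbb D$. For $\phi$ analytic on $\mathbb D$ with $\phi(0)=1$, let $\mathcal S^*(\phi)$ be the class of all $f\in\mathcal S$ with $zf'(z)/f(z)\prec\phi(z)$, that is, $zf'(z)/f(z)=\phi(\omega(z))$ on $\mathbb D$ (with value $1$ at $z=0$) for some analytic $\omega:\mathbb D\to\mathbb D$ with $\omega(0)=0$. Let $0\le\alpha<0.05284$, $\phi_\alpha(z)=\alpha+(1-\alpha)e^z$, and $\mathcal S^*_{\alpha,e}=\mathcal S^*(\phi_\alpha)$. Then there is a function $h\in\mathcal S$ with $zh'(z)/h(z)=\phi_\alpha(z)$ on $\mathbb D$, and for any such $h$ the following hold. The limit $h(-1):=\lim_{r\to1^-}h(-r)$ exists, the equation $$h(r)+h(-1)=0$$ has a smallest root $r_f$ in $(0,1)$, and $0<r_f<1/3$. Every $f\in\mathcal S^*_{\alpha,e}$ satisfies $$|z|+\sum_{n=2}^\infty|a_n||z|^n\le d\bigl(f(0),\partial f(\mathbb D)\bigr)\qquad\text{for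 } |z|\le r_f,$$ where $d$ is the Euclidean distance. The radius is the best possible: $r_f$ is the largest number $\rho\in(0,1)$ such that this inequality holds for all $f\in\mathcal S^*_{\alpha,e}$ and all $|z|\le\rho$. In particular, for $\alpha=0$ the number $r_f$ is the sharp Bohr radius of $\mathcal S^*_e=\mathcal S^*(e^z)$. -/

import Mathlib

open Set Filter Topology Metric

noncomputable section

namespace BohrStarlike

/-- The open unit disk. -/
def disk : Set ℂ := ball (0 : ℂ) 1

/-- The class of normalized univalent functions: `f` is analytic and injective on the unit disk,
`f 0 = 0` and `f' 0 = 1`. Values outside the disk are irrelevant. -/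
def Univalent : Set (ℂ → ℂ) :=
  {f | DifferentiableOn ℂ f disk ∧ InjOn f disk ∧ f 0 = 0 ∧ deriv f 0 = 1}

/-- Subordination `g ≺ φ` in the unit disk: `g = φ ∘ ω` for an analytic self-map `ω` of the disk
that fixes the origin. -/
def Subordinate (g φ : ℂ → ℂ) : Prop :=
  ∃ ω : ℂ → ℂ, DifferentiableOn ℂ ω disk ∧ MapsTo ω disk disk ∧ ω 0 = 0 ∧
    ∀ z ∈ disk, g z = φ (ω z)

/-- The function `z f'(z) / f(z)`, with its removable singularity at the origin filled in: for `f`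
with `f 0 = 0` and `f' 0 = 1` the limit at `0` is `1`. -/
def starQuotient (f : ℂ → ℂ) (z : ℂ) : ℂ :=
  if z = 0 then 1 else z * deriv f z / f z

/-- The Ma-Minda type starlike class of `φ`. -/
def maMindaStarlike (φ : ℂ → ℂ) : Set (ℂ → ℂ) :=
  {f | f ∈ Univalent ∧ Subordinate (starQuotient f) φ}

/-- `h` is the Koebe-type function of the Ma-Minda class of `φ`: a normalized univalent function
with `z h'(z) / h(z) = φ z` on the disk. -/
def IsKoebeFunction (φ h : ℂ → ℂ) : Prop :=
  h ∈ Univalent ∧ ∀ z ∈ disk, starQuotient h z = φ z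

/-- The function `α + (1 - α) e ^ z`. -/
def expFun (α : ℝ) (z : ℂ) : ℂ := (α : ℂ) + (1 - (α : ℂ)) * Complex.exp z

/-- The `n`-th Taylor coefficient of `f` at the origin. -/
def taylorCoeff (f : ℂ → ℂ) (n : ℕ) : ℂ := iteratedDeriv n f 0 / (n.factorial : ℂ)

/-- The Bohr inequality `|z| + ∑_{n ≥ 2} |a_n| |z| ^ n ≤ d (f 0, ∂ f(𝔻))` at the point `z`, with
both sides in `[0, ∞]`, so that no convergence or non-emptiness convention enters. -/
def BohrInequality (f : ℂ → ℂ) (z : ℂ) : Prop :=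
  ‖z‖ₑ + ∑' n : ℕ, ‖taylorCoeff f (n + 2)‖ₑ * ‖z‖ₑ ^ (n + 2)
    ≤ infEDist (f 0) (frontier (f '' disk))

/-- `R` is the (sharp) Bohr radius of the class `F` of normalized functions: the largest number in
`(0, 1)` such that every `f ∈ F` satisfies the Bohr inequality for `|z| ≤ R`. -/
def IsBohrRadius (F : Set (ℂ → ℂ)) (R : ℝ) : Prop :=
  IsGreatest {ρ : ℝ | ρ ∈ Ioo (0 : ℝ) 1 ∧ ∀ f ∈ F, ∀ z : ℂ, ‖z‖ ≤ ρ → BohrInequality f z} R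

end BohrStarlike

end

noncomputable section

namespace BohrStarlike

/-! Write `E` for `expIntegral`, the primitive of `(e ^ z - 1) / z` vanishing at `0`. The equation
`z h' / h = φ_α` forces `h z = z * exp ((1 - α) * E z)`, and a general `f` in the class is `z * exp
(g z)` with `g' = (φ_α ∘ ω - 1) / z`. Both sides of the Bohr inequality are compared with values of
`h` on the real axis (`koebeReal`).

Upper bound (`majorant_le_koebeReal`): the majorant `M f r = ∑ |a_n| r ^ n` is subadditive and
submultiplicative. Bohr's theorem applied to `ω z / z` gives `M ω r ≤ r` for `r ≤ 1 / 3`.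
Exponentiating, integrating and exponentiating again yields `M f r ≤ h r`.

Lower bound (`ofReal_le_infEDist_frontier`): on `|w| ≤ ρ ≤ 1` the real part of `e ^ w` is least at
`w = -ρ`. Integrating along rays gives `|f z| ≥ -h (-|z|)`, so the boundary of the image lies at
distance at least `-h (-1)` from `0`.

Hence the inequality holds as long as `h r ≤ -h (-1)` and `r ≤ 1 / 3`. It fails for `h` itself
beyond the root, because `h (-1)` is a boundary point of the image of `h`. The root lies below `1 /
3` exactly when `exp ((1 - α) * (E (1 / 3) - E (-1))) > 3`, which is what the bound on `α` ensures
(`three_lt_exp_mul`). -/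

lemma isOpen_disk : IsOpen disk := isOpen_ball

lemma zero_mem_disk : (0 : ℂ) ∈ disk := by simp [disk]

lemma mem_disk {z : ℂ} : z ∈ disk ↔ ‖z‖ < 1 := by simp [disk]

lemma disk_mem_nhds_zero : disk ∈ 𝓝 (0 : ℂ) := isOpen_disk.mem_nhds zero_mem_disk

lemma analyticAt_zero {f : ℂ → ℂ} (hf : DifferentiableOn ℂ f disk) : AnalyticAt ℂ f 0 :=
  hf.analyticAt disk_mem_nhds_zero

/-! ### Taylor coefficients at the origin -/

lemma taylorCoeff_zero (f : ℂ → ℂ) : taylorCoeff f 0 = f 0 := by simp [taylorCoeff]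

lemma taylorCoeff_congr {f g : ℂ → ℂ} (h : f =ᶠ[𝓝 0] g) (n : ℕ) :
    taylorCoeff f n = taylorCoeff g n := by
  rw [taylorCoeff, taylorCoeff, h.iteratedDeriv_eq n]

lemma taylorCoeff_deriv (f : ℂ → ℂ) (n : ℕ) :
    taylorCoeff (deriv f) n = (n + 1) * taylorCoeff f (n + 1) := by
  have h : (n.factorial : ℂ) ≠ 0 := by exact_mod_cast n.factorial_ne_zero
  have h' : (n + 1 : ℂ) ≠ 0 := by exact_mod_cast n.succ_ne_zero
  rw [taylorCoeff, taylorCoeff, iteratedDeriv_succ', Nat.factorial_succ]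
  push_cast
  field_simp

lemma taylorCoeff_add {f g : ℂ → ℂ} (hf : AnalyticAt ℂ f 0) (hg : AnalyticAt ℂ g 0) (n : ℕ) :
    taylorCoeff (fun z => f z + g z) n = taylorCoeff f n + taylorCoeff g n := by
  rw [taylorCoeff, iteratedDeriv_fun_add hf.contDiffAt hg.contDiffAt, add_div]
  rfl

lemma taylorCoeff_const_mul (c : ℂ) (f : ℂ → ℂ) (n : ℕ) :
    taylorCoeff (fun z => c * f z) n = c * taylorCoeff f n := by
  rw [taylorCoeff, iteratedDeriv_const_mul_field, mul_div_assoc]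
  rfl

lemma taylorCoeff_const_succ (c : ℂ) (n : ℕ) : taylorCoeff (fun _ => c) (n + 1) = 0 := by
  simp [taylorCoeff, iteratedDeriv_const]

lemma taylorCoeff_mul {f g : ℂ → ℂ} (hf : AnalyticAt ℂ f 0) (hg : AnalyticAt ℂ g 0) (n : ℕ) :
    taylorCoeff (fun z => f z * g z) n =
      ∑ p ∈ Finset.HasAntidiagonal.antidiagonal n, taylorCoeff f p.1 * taylorCoeff g p.2 := by
  have h : (n.factorial : ℂ) ≠ 0 := by exact_mod_cast n.factorial_ne_zero
  rw [Finset.Nat.sum_antidiagonal_eq_sum_range_succ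
    (fun i j => taylorCoeff f i * taylorCoeff g j), taylorCoeff,
    iteratedDeriv_fun_mul hf.contDiffAt hg.contDiffAt, Finset.sum_div]
  refine Finset.sum_congr rfl fun i hi => ?_
  have hi' : i ≤ n := Nat.lt_succ_iff.mp (Finset.mem_range.mp hi)
  have h1 : (i.factorial : ℂ) ≠ 0 := by exact_mod_cast i.factorial_ne_zero
  have h2 : ((n - i).factorial : ℂ) ≠ 0 := by exact_mod_cast (n - i).factorial_ne_zero
  rw [Nat.cast_choose ℂ hi', taylorCoeff, taylorCoeff]
  field_simp

lemma taylorCoeff_id_mul_succ {f : ℂ → ℂ} (hf : AnalyticAt ℂ f 0) (n : ℕ) :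
    taylorCoeff (fun z => z * f z) (n + 1) = taylorCoeff f n := by
  have hid : ∀ k, taylorCoeff (fun z : ℂ => z) (k + 1) = if k = 0 then 1 else 0 := by
    intro k
    have h := taylorCoeff_deriv (fun z : ℂ => z) k
    rw [deriv_id''] at h
    rcases k with _ | k
    · simpa [taylorCoeff_zero] using h.symm
    · rw [taylorCoeff_const_succ] at h
      have : ((k + 1 : ℕ) + 1 : ℂ) ≠ 0 := by exact_mod_cast (k + 1).succ_ne_zero
      simpa [this] using (mul_eq_zero.mp h.symm).resolve_left this
  rw [taylorCoeff_mul (f := fun z => z) analyticAt_id hf, Finset.Nat.sum_antidiagonal_succ,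
    Finset.Nat.sum_antidiagonal_eq_sum_range_succ
      (fun i j => taylorCoeff (fun z : ℂ => z) (i + 1) * taylorCoeff f j)]
  simp [taylorCoeff_zero, hid]

lemma hasSum_taylorCoeff {f : ℂ → ℂ} (hf : DifferentiableOn ℂ f disk) {z : ℂ} (hz : z ∈ disk) :
    HasSum (fun n => taylorCoeff f n * z ^ n) (f z) := by
  have h := Complex.hasSum_taylorSeries_on_ball hf hz
  simp only [sub_zero, smul_eq_mul] at h
  have h' : (fun n => taylorCoeff f n * z ^ n) =
      fun n : ℕ => (n.factorial : ℂ)⁻¹ * (z ^ n * iteratedDeriv n f 0) := by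
    ext n
    rw [taylorCoeff]
    ring
  rwa [h']

/-! ### Majorant series -/

/-- The majorant `∑ |a_n| r ^ n` of the Taylor series of `f` at the origin. -/
def majorant (f : ℂ → ℂ) (r : ENNReal) : ENNReal := ∑' n, ‖taylorCoeff f n‖ₑ * r ^ n

lemma majorant_congr {f g : ℂ → ℂ} (h : f =ᶠ[𝓝 0] g) (r : ENNReal) :
    majorant f r = majorant g r :=
  tsum_congr fun n => by rw [taylorCoeff_congr h]

lemma majorant_eq_zero_add (f : ℂ → ℂ) (r : ENNReal) :
    majorant f r = ‖f 0‖ₑ + ∑' n, ‖taylorCoeff f (n + 1)‖ₑ * r ^ (n + 1) := by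
  rw [majorant, tsum_eq_zero_add' ENNReal.summable, taylorCoeff_zero, pow_zero, mul_one]

lemma majorant_add_le {f g : ℂ → ℂ} (hf : AnalyticAt ℂ f 0) (hg : AnalyticAt ℂ g 0)
    (r : ENNReal) : majorant (fun z => f z + g z) r ≤ majorant f r + majorant g r := by
  rw [majorant, majorant, majorant, ← ENNReal.tsum_add]
  refine ENNReal.tsum_le_tsum fun n => ?_
  rw [taylorCoeff_add hf hg, ← add_mul]
  gcongr
  exact enorm_add_le _ _

lemma majorant_const_mul (c : ℂ) (f : ℂ → ℂ) (r : ENNReal) :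
    majorant (fun z => c * f z) r = ‖c‖ₑ * majorant f r := by
  simp only [majorant, taylorCoeff_const_mul, enorm_mul, mul_assoc, ENNReal.tsum_mul_left]

lemma majorant_const (c : ℂ) (r : ENNReal) : majorant (fun _ => c) r = ‖c‖ₑ := by
  simp [majorant_eq_zero_add, taylorCoeff_const_succ]

lemma majorant_id_mul {f : ℂ → ℂ} (hf : AnalyticAt ℂ f 0) (r : ENNReal) :
    majorant (fun z => z * f z) r = r * majorant f r := by
  rw [majorant_eq_zero_add]
  simp only [taylorCoeff_id_mul_succ hf, zero_mul, enorm_zero, zero_add, majorant,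
    ← ENNReal.tsum_mul_left]
  refine tsum_congr fun n => ?_
  ring

/-- Cauchy product and the triangle inequality; in `[0, ∞]` the double sum may be regrouped by
antidiagonals without any convergence condition. -/
lemma majorant_mul_le {f g : ℂ → ℂ} (hf : AnalyticAt ℂ f 0) (hg : AnalyticAt ℂ g 0)
    (r : ENNReal) : majorant (fun z => f z * g z) r ≤ majorant f r * majorant g r := by
  have h : majorant f r * majorant g r = ∑' n, ∑ p ∈ Finset.HasAntidiagonal.antidiagonal n,
      (‖taylorCoeff f p.1‖ₑ * r ^ p.1) * (‖taylorCoeff g p.2‖ₑ * r ^ p.2) := by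
    rw [majorant, majorant, ← ENNReal.tsum_mul_right]
    simp_rw [← ENNReal.tsum_mul_left]
    rw [← ENNReal.tsum_prod, ← (Finset.HasAntidiagonal.sigmaAntidiagonalEquivProd (A := ℕ)).tsum_eq,
      ENNReal.tsum_sigma']
    refine tsum_congr fun n => ?_
    rw [tsum_fintype, Finset.univ_eq_attach,
      ← Finset.sum_attach (Finset.HasAntidiagonal.antidiagonal n)]
    rfl
  rw [h]
  refine ENNReal.tsum_le_tsum fun n => ?_
  rw [taylorCoeff_mul hf hg]
  refine (mul_le_mul_left (enorm_sum_le _ _) _).trans ?_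
  rw [Finset.sum_mul]
  refine Finset.sum_le_sum fun p hp => le_of_eq ?_
  rw [enorm_mul, ← Finset.HasAntidiagonal.mem_antidiagonal.mp hp, pow_add]
  ring

lemma majorant_pow_le {f : ℂ → ℂ} (hf : AnalyticAt ℂ f 0) (r : ENNReal) (k : ℕ) :
    majorant (fun z => f z ^ k) r ≤ majorant f r ^ k := by
  induction k with
  | zero => simp [majorant_const]
  | succ k ih =>
    simp only [pow_succ]
    exact (majorant_mul_le (hf.pow k) hf r).trans (mul_le_mul_left ih _)

/-! ### Majorant of an exponential -/

/-- The partial sums of the exponential series of `f`. -/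
def expPartial (f : ℂ → ℂ) (N : ℕ) (z : ℂ) : ℂ :=
  ∑ k ∈ Finset.range (N + 1), (k.factorial : ℂ)⁻¹ * f z ^ k

lemma expPartial_succ (f : ℂ → ℂ) (N : ℕ) (z : ℂ) :
    expPartial f (N + 1) z = expPartial f N z + ((N + 1).factorial : ℂ)⁻¹ * f z ^ (N + 1) := by
  rw [expPartial, Finset.sum_range_succ]
  rfl

lemma analyticAt_expPartial {f : ℂ → ℂ} {z : ℂ} (hf : AnalyticAt ℂ f z) (N : ℕ) :
    AnalyticAt ℂ (expPartial f N) z := by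
  have : expPartial f N =
      fun z => ∑ k ∈ Finset.range (N + 1), (k.factorial : ℂ)⁻¹ * f z ^ k := rfl
  rw [this]
  fun_prop

/-- Truncated form of `(e ^ f)' = f' e ^ f`: differentiation lowers the truncation order by one,
which drives the induction in `taylorCoeff_exp_comp_eq`. -/
lemma hasDerivAt_expPartial_succ {f : ℂ → ℂ} {z : ℂ} (hf : DifferentiableAt ℂ f z) (N : ℕ) :
    HasDerivAt (expPartial f (N + 1)) (deriv f z * expPartial f N z) z := by
  induction N with
  | zero =>
    have : expPartial f (0 + 1) = fun z => 1 + f z := by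
      ext z; simp [expPartial, Finset.sum_range_succ]
    rw [this]
    simpa [expPartial] using hf.hasDerivAt.const_add 1
  | succ N ih =>
    have : expPartial f (N + 1 + 1) = fun z =>
        expPartial f (N + 1) z + ((N + 1 + 1).factorial : ℂ)⁻¹ * f z ^ (N + 1 + 1) := by
      ext z; exact expPartial_succ _ _ _
    rw [this]
    convert ih.add ((hf.hasDerivAt.pow (N + 1 + 1)).const_mul ((N + 1 + 1).factorial : ℂ)⁻¹)
      using 1
    any_goals rfl
    rw [expPartial_succ f N z, Nat.factorial_succ (N + 1)]
    have h1 : ((N + 1).factorial : ℂ) ≠ 0 := by exact_mod_cast (N + 1).factorial_ne_zero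
    have h2 : ((N + 1 : ℕ) + 1 : ℂ) ≠ 0 := by exact_mod_cast (N + 1).succ_ne_zero
    push_cast at h2 ⊢
    field_simp

/-- Both derivatives are `f'` times a function of the same kind, so coefficient `n + 1` depends only
on coefficients up to `n`. The condition `f 0 = 0` matches the constant terms. -/
lemma taylorCoeff_exp_comp_eq {f : ℂ → ℂ} (hf : AnalyticAt ℂ f 0) (hf0 : f 0 = 0) {N n : ℕ}
    (hn : n ≤ N) : taylorCoeff (fun z => Complex.exp (f z)) n = taylorCoeff (expPartial f N) n := by
  induction N generalizing n with
  | zero =>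
    obtain rfl : n = 0 := by omega
    simp [taylorCoeff_zero, expPartial, hf0]
  | succ N ih =>
    rcases n with _ | n
    · simp [taylorCoeff_zero, expPartial, hf0, Finset.sum_range_succ']
    have hev : ∀ᶠ z in 𝓝 0, AnalyticAt ℂ f z := hf.eventually_analyticAt
    have h1 : deriv (fun z => Complex.exp (f z)) =ᶠ[𝓝 0]
        fun z => deriv f z * Complex.exp (f z) := by
      filter_upwards [hev] with z hz
      rw [(hz.differentiableAt.hasDerivAt.cexp).deriv, mul_comm]
    have h2 : deriv (expPartial f (N + 1)) =ᶠ[𝓝 0] fun z => deriv f z * expPartial f N z := by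
      filter_upwards [hev] with z hz
      exact (hasDerivAt_expPartial_succ hz.differentiableAt N).deriv
    have h3 : (n + 1 : ℂ) ≠ 0 := by exact_mod_cast n.succ_ne_zero
    refine mul_left_cancel₀ h3 ?_
    rw [← taylorCoeff_deriv, ← taylorCoeff_deriv, taylorCoeff_congr h1, taylorCoeff_congr h2,
      taylorCoeff_mul (g := fun z => Complex.exp (f z)) hf.deriv hf.cexp, taylorCoeff_mul hf.deriv (analyticAt_expPartial hf N)]
    refine Finset.sum_congr rfl fun p hp => ?_
    have := Finset.HasAntidiagonal.mem_antidiagonal.mp hp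
    rw [ih (by omega)]

lemma majorant_expPartial_le {f : ℂ → ℂ} (hf : AnalyticAt ℂ f 0) (r : ENNReal) (N : ℕ) :
    majorant (expPartial f N) r ≤
      ∑ k ∈ Finset.range (N + 1), ‖(k.factorial : ℂ)⁻¹‖ₑ * majorant f r ^ k := by
  induction N with
  | zero =>
    have : expPartial f 0 = fun _ => 1 := by ext; simp [expPartial]
    simp [this, majorant_const]
  | succ N ih =>
    rw [Finset.sum_range_succ]
    have : expPartial f (N + 1) = fun z =>
        expPartial f N z + ((N + 1).factorial : ℂ)⁻¹ * f z ^ (N + 1) := by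
      ext z; exact expPartial_succ _ _ _
    rw [this]
    refine (majorant_add_le (analyticAt_expPartial hf N)
      (analyticAt_const.mul (hf.pow _)) r).trans (add_le_add ih ?_)
    refine (majorant_const_mul _ (fun z => f z ^ (N + 1)) r).le.trans ?_
    gcongr
    exact majorant_pow_le hf r _

/-- Each partial sum of the majorant sees only a truncated exponential, whose majorant is at most `∑
x ^ k / k! ≤ e ^ x`. -/
lemma majorant_exp_comp_le {f : ℂ → ℂ} (hf : AnalyticAt ℂ f 0) (hf0 : f 0 = 0) {r : ENNReal}
    {x : ℝ} (hx : 0 ≤ x) (h : majorant f r ≤ ENNReal.ofReal x) :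
    majorant (fun z => Complex.exp (f z)) r ≤ ENNReal.ofReal (Real.exp x) := by
  refine ENNReal.tsum_le_of_sum_range_le fun N => ?_
  calc ∑ n ∈ Finset.range N, ‖taylorCoeff (fun z => Complex.exp (f z)) n‖ₑ * r ^ n
      = ∑ n ∈ Finset.range N, ‖taylorCoeff (expPartial f N) n‖ₑ * r ^ n := by
        refine Finset.sum_congr rfl fun n hn => ?_
        rw [taylorCoeff_exp_comp_eq hf hf0 (Finset.mem_range.mp hn).le]
    _ ≤ majorant (expPartial f N) r := ENNReal.sum_le_tsum _
    _ ≤ ∑ k ∈ Finset.range (N + 1), ‖(k.factorial : ℂ)⁻¹‖ₑ * majorant f r ^ k :=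
        majorant_expPartial_le hf r N
    _ ≤ ∑ k ∈ Finset.range (N + 1), ENNReal.ofReal (x ^ k / k.factorial) := by
        refine Finset.sum_le_sum fun k _ => ?_
        rw [div_eq_inv_mul, ENNReal.ofReal_mul (by positivity), ENNReal.ofReal_pow hx]
        gcongr
        rw [← ofReal_norm]
        simp
    _ = ENNReal.ofReal (∑ k ∈ Finset.range (N + 1), x ^ k / k.factorial) := by
        rw [ENNReal.ofReal_sum_of_nonneg fun k _ => by positivity]
    _ ≤ ENNReal.ofReal (Real.exp x) :=
        ENNReal.ofReal_le_ofReal (Real.sum_le_exp_of_nonneg hx _)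

/-! ### Carathéodory's and Bohr's theorems -/

lemma circleMap_conj_pow (r : ℝ) (hr : r ≠ 0) (θ : ℝ) (n : ℕ) :
    (starRingEnd ℂ) (circleMap 0 r θ ^ n) = (r : ℂ) ^ (2 * n) * (circleMap 0 r θ ^ n)⁻¹ := by
  have hu : circleMap 0 r θ ≠ 0 := circleMap_ne_center hr
  have h : (starRingEnd ℂ) (circleMap 0 r θ) * circleMap 0 r θ = (r : ℂ) ^ 2 := by
    rw [mul_comm, Complex.mul_conj, Complex.normSq_eq_norm_sq]
    simp
  rw [eq_mul_inv_iff_mul_eq₀ (pow_ne_zero n hu), map_pow, ← mul_pow, h, pow_mul]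

/-- Carathéodory's coefficient bound on a circle of radius `r < 1`. -/
lemma norm_taylorCoeff_mul_pow_le {p : ℂ → ℂ} (hp : DifferentiableOn ℂ p disk)
    (hre : ∀ z ∈ disk, 0 ≤ (p z).re) {n : ℕ} (hn : n ≠ 0) {r : ℝ} (hr : 0 < r) (hr1 : r < 1) :
    ‖taylorCoeff p n‖ * r ^ n ≤ 2 * (p 0).re := by
  have hsub : closedBall (0 : ℂ) r ⊆ disk := closedBall_subset_ball hr1
  have hmem : ∀ θ, circleMap 0 r θ ∈ disk := fun θ => by
    rw [mem_disk, norm_circleMap_zero, abs_of_pos hr]; exact hr1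
  have hu : ∀ θ, circleMap 0 r θ ≠ 0 := fun θ => circleMap_ne_center hr.ne'
  have hcp : Continuous fun θ => p (circleMap 0 r θ) :=
    hp.continuousOn.comp_continuous (continuous_circleMap 0 r) hmem
  have hcu : Continuous fun θ => circleMap 0 r θ := continuous_circleMap 0 r
  have hcinv : Continuous fun θ => (circleMap 0 r θ ^ n)⁻¹ :=
    (hcu.pow n).inv₀ fun θ => pow_ne_zero n (hu θ)
  have hcauchy : ∀ k : ℕ, ∫ θ in (0 : ℝ)..2 * Real.pi,
      (circleMap 0 r θ ^ k)⁻¹ * p (circleMap 0 r θ) = 2 * Real.pi * taylorCoeff p k := by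
    intro k
    have h := (hp.mono hsub).circleIntegral_one_div_sub_center_pow_smul hr k
    rw [circleIntegral] at h
    have h' : ∀ θ, deriv (circleMap 0 r) θ • (1 / (circleMap 0 r θ - 0) ^ (k + 1)) •
        p (circleMap 0 r θ) = Complex.I * ((circleMap 0 r θ ^ k)⁻¹ * p (circleMap 0 r θ)) := by
      intro θ
      have := hu θ
      simp only [deriv_circleMap, smul_eq_mul, sub_zero]
      field_simp
      ring
    simp only [h', intervalIntegral.integral_const_mul] at h
    refine mul_left_cancel₀ Complex.I_ne_zero ?_
    rw [h, taylorCoeff, smul_eq_mul]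
    ring
  -- Fourier coefficients of `p` of negative index vanish. Conjugated, this lets `p` be replaced by
  -- `p + conj p = 2 Re p` in the formula for the `n`-th coefficient, and nonnegativity then bounds
  -- it by the mean of `2 Re p`.
  have hzero : ∫ θ in (0 : ℝ)..2 * Real.pi,
      circleMap 0 r θ ^ n * p (circleMap 0 r θ) = 0 := by
    have hd : DifferentiableOn ℂ (fun z => z ^ (n - 1) * p z) (closedBall 0 r) :=
      (differentiableOn_pow (n - 1)).mul (hp.mono hsub)
    have h := (hd.mono closure_ball_subset_closedBall).diffContOnCl.circleIntegral_eq_zero hr.le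
    rw [circleIntegral] at h
    have h' : ∀ θ, deriv (circleMap 0 r) θ • (circleMap 0 r θ ^ (n - 1) *
        p (circleMap 0 r θ)) = Complex.I * (circleMap 0 r θ ^ n * p (circleMap 0 r θ)) := by
      intro θ
      obtain ⟨m, rfl⟩ := Nat.exists_eq_succ_of_ne_zero hn
      simp only [deriv_circleMap, smul_eq_mul, Nat.succ_eq_add_one, Nat.add_sub_cancel]
      ring
    simp only [h', intervalIntegral.integral_const_mul] at h
    exact (mul_eq_zero.mp h).resolve_left Complex.I_ne_zero
  have hconj : ∫ θ in (0 : ℝ)..2 * Real.pi,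
      (circleMap 0 r θ ^ n)⁻¹ * (starRingEnd ℂ) (p (circleMap 0 r θ)) = 0 := by
    have h := (Complex.conjCLE : ℂ →L[ℝ] ℂ).intervalIntegral_comp_comm
      (μ := MeasureTheory.volume) (((hcu.pow n).mul hcp).intervalIntegrable 0 (2 * Real.pi))
    simp only [Pi.mul_apply, Pi.pow_apply] at h
    rw [hzero, map_zero] at h
    simp only [ContinuousLinearEquiv.coe_coe, Complex.conjCLE_apply, map_mul, circleMap_conj_pow r hr.ne', mul_assoc,
      intervalIntegral.integral_const_mul] at h
    exact (mul_eq_zero.mp h).resolve_left (pow_ne_zero _ (by exact_mod_cast hr.ne'))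
  have hre0 : ∫ θ in (0 : ℝ)..2 * Real.pi, (p (circleMap 0 r θ)).re =
      2 * Real.pi * (p 0).re := by
    have h := hcauchy 0
    simp only [pow_zero, inv_one, one_mul, taylorCoeff_zero] at h
    have h2 := congrArg Complex.re h
    have h3 := Complex.reCLM.intervalIntegral_comp_comm
      (μ := MeasureTheory.volume) (hcp.intervalIntegrable 0 (2 * Real.pi))
    simp only [Complex.reCLM_apply] at h3
    rw [h3, h2]
    simp
  have hA : ∫ θ in (0 : ℝ)..2 * Real.pi,
      (circleMap 0 r θ ^ n)⁻¹ * ((2 * (p (circleMap 0 r θ)).re : ℝ) : ℂ) =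
        2 * Real.pi * taylorCoeff p n := by
    have h := intervalIntegral.integral_add
        (μ := MeasureTheory.volume) ((hcinv.mul hcp).intervalIntegrable 0 (2 * Real.pi))
        ((hcinv.mul (Complex.continuous_conj.comp hcp)).intervalIntegrable 0 (2 * Real.pi))
    simp only [Pi.mul_apply, Function.comp_apply, ← mul_add, Complex.add_conj] at h
    rw [h, hcauchy n, hconj, add_zero]
  have hbound : ‖∫ θ in (0 : ℝ)..2 * Real.pi,
      (circleMap 0 r θ ^ n)⁻¹ * ((2 * (p (circleMap 0 r θ)).re : ℝ) : ℂ)‖ ≤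
        ∫ θ in (0 : ℝ)..2 * Real.pi, (r ^ n)⁻¹ * (2 * (p (circleMap 0 r θ)).re) := by
    refine (intervalIntegral.norm_integral_le_integral_norm Real.two_pi_pos.le).trans_eq ?_
    refine intervalIntegral.integral_congr fun θ _ => ?_
    simp only [norm_mul, norm_inv, norm_pow, norm_circleMap_zero, abs_of_pos hr,
      Complex.norm_real, Real.norm_eq_abs]
    simp [abs_of_nonneg (hre _ (hmem θ))]
  rw [hA, intervalIntegral.integral_const_mul, intervalIntegral.integral_const_mul, hre0,
    norm_mul] at hbound
  have hpi : ‖(2 * Real.pi : ℂ)‖ = 2 * Real.pi := by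
    simp [abs_of_pos Real.pi_pos]
  rw [hpi] at hbound
  have hrn : 0 < r ^ n := pow_pos hr n
  have h4 : (2 * Real.pi) * ‖taylorCoeff p n‖ ≤ (2 * Real.pi) * ((r ^ n)⁻¹ * (2 * (p 0).re)) := by
    linarith
  have h5 := le_of_mul_le_mul_left h4 Real.two_pi_pos
  rwa [inv_mul_eq_div, le_div_iff₀ hrn] at h5

/-- Carathéodory's bound for the coefficients of a function with nonnegative real part. -/
lemma norm_taylorCoeff_le_two_mul_re {p : ℂ → ℂ} (hp : DifferentiableOn ℂ p disk)
    (hre : ∀ z ∈ disk, 0 ≤ (p z).re) {n : ℕ} (hn : n ≠ 0) :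
    ‖taylorCoeff p n‖ ≤ 2 * (p 0).re := by
  have hlim : Tendsto (fun r : ℝ => ‖taylorCoeff p n‖ * r ^ n) (𝓝[<] 1)
      (𝓝 (‖taylorCoeff p n‖ * 1 ^ n)) :=
    ((continuous_const.mul (continuous_pow n)).tendsto 1).mono_left nhdsWithin_le_nhds
  rw [one_pow, mul_one] at hlim
  refine le_of_tendsto hlim ?_
  filter_upwards [Ioo_mem_nhdsLT (zero_lt_one' ℝ)] with r hr
  exact norm_taylorCoeff_mul_pow_le hp hre hn hr.1 hr.2

lemma norm_taylorCoeff_le_of_norm_le_one {f : ℂ → ℂ} (hf : DifferentiableOn ℂ f disk)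
    (hb : ∀ z ∈ disk, ‖f z‖ ≤ 1) {n : ℕ} (hn : n ≠ 0) :
    ‖taylorCoeff f n‖ ≤ 2 * (1 - ‖f 0‖) := by
  -- The rotation `c` makes `1 + c * f`, whose real part is nonnegative, take the value `1 - ‖f 0‖`
  -- at the origin.
  obtain ⟨c, hc, hc0⟩ : ∃ c : ℂ, ‖c‖ = 1 ∧ c * f 0 = -(‖f 0‖ : ℂ) := by
    by_cases h0 : f 0 = 0
    · exact ⟨1, by simp, by simp [h0]⟩
    · have h1 : (‖f 0‖ : ℂ) ≠ 0 := by exact_mod_cast norm_ne_zero_iff.mpr h0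
      refine ⟨-(‖f 0‖ : ℂ) / f 0, by simp [h0], by field_simp⟩
  have han := analyticAt_zero hf
  have hd : DifferentiableOn ℂ (fun z => 1 + c * f z) disk :=
    (hf.const_mul c).const_add 1
  have h := norm_taylorCoeff_le_two_mul_re hd (fun z hz => ?_) hn
  · obtain ⟨m, rfl⟩ := Nat.exists_eq_succ_of_ne_zero hn
    rw [taylorCoeff_add (f := fun _ => 1) (g := fun z => c * f z) analyticAt_const
        (analyticAt_const.mul han),
      Nat.succ_eq_add_one, taylorCoeff_const_succ, taylorCoeff_const_mul, zero_add, norm_mul, hc,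
      one_mul, hc0] at h
    simpa [sub_eq_add_neg] using h
  · have h1 : ‖c * f z‖ ≤ 1 := by rw [norm_mul, hc, one_mul]; exact hb z hz
    have h2 := (abs_le.mp ((Complex.abs_re_le_norm _).trans h1)).1
    rw [Complex.add_re, Complex.one_re]
    linarith

/-- Bohr's theorem: the majorant of a function bounded by one is at most one for `r ≤ 1 / 3`. -/
lemma majorant_le_one_of_norm_le_one {f : ℂ → ℂ} (hf : DifferentiableOn ℂ f disk)
    (hb : ∀ z ∈ disk, ‖f z‖ ≤ 1) {r : ℝ} (hr0 : 0 ≤ r) (hr : r ≤ 1 / 3) :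
    majorant f (ENNReal.ofReal r) ≤ 1 := by
  have h0 : ‖f 0‖ ≤ 1 := hb 0 zero_mem_disk
  have hgeom : HasSum (fun n : ℕ => 2 * (1 - ‖f 0‖) * r * r ^ n)
      (2 * (1 - ‖f 0‖) * r * (1 - r)⁻¹) :=
    (hasSum_geometric_of_lt_one hr0 (by linarith)).mul_left _
  calc majorant f (ENNReal.ofReal r)
      ≤ ‖f 0‖ₑ + ∑' n : ℕ, ENNReal.ofReal (2 * (1 - ‖f 0‖) * r * r ^ n) := by
        rw [majorant_eq_zero_add]
        gcongr with n
        rw [← ofReal_norm, ← ENNReal.ofReal_pow hr0, ← ENNReal.ofReal_mul (norm_nonneg _)]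
        refine ENNReal.ofReal_le_ofReal ?_
        rw [mul_assoc _ r, ← pow_succ']
        gcongr
        exact norm_taylorCoeff_le_of_norm_le_one hf hb n.succ_ne_zero
    _ = ENNReal.ofReal (‖f 0‖ + 2 * (1 - ‖f 0‖) * r * (1 - r)⁻¹) := by
        rw [← ENNReal.ofReal_tsum_of_nonneg (fun n => ?_) hgeom.summable, hgeom.tsum_eq,
          ENNReal.ofReal_add (norm_nonneg _), ofReal_norm]
        · have : 0 ≤ (1 - r)⁻¹ := inv_nonneg.mpr (by linarith)
          have : 0 ≤ 1 - ‖f 0‖ := by linarith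
          positivity
        · have : 0 ≤ 1 - ‖f 0‖ := by linarith
          positivity
    _ ≤ ENNReal.ofReal 1 := by
        refine ENNReal.ofReal_le_ofReal ?_
        -- This is where `1 / 3` comes from: `2 r / (1 - r) ≤ 1` exactly up to that radius.
        have h1 : r * (1 - r)⁻¹ ≤ 1 / 2 := by
          rw [← div_eq_mul_inv, div_le_iff₀ (by linarith)]
          linarith
        nlinarith
    _ = 1 := ENNReal.ofReal_one

lemma id_mul_dslope (f : ℂ → ℂ) (z : ℂ) : z * dslope f 0 z = f z - f 0 := by
  simpa using sub_smul_dslope f 0 z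

lemma differentiableOn_dslope_disk {f : ℂ → ℂ} (hf : DifferentiableOn ℂ f disk) :
    DifferentiableOn ℂ (dslope f 0) disk :=
  (Complex.differentiableOn_dslope disk_mem_nhds_zero).mpr hf

/-- The majorant of a Schwarz function is at most the identity for `r ≤ 1 / 3`. -/
lemma majorant_schwarz_le {w : ℂ → ℂ} (hw : DifferentiableOn ℂ w disk) (hm : MapsTo w disk disk)
    (h0 : w 0 = 0) {r : ℝ} (hr0 : 0 ≤ r) (hr : r ≤ 1 / 3) :
    majorant w (ENNReal.ofReal r) ≤ ENNReal.ofReal r := by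
  have hd := differentiableOn_dslope_disk hw
  have heq : w = fun z => z * dslope w 0 z := by
    ext z
    rw [id_mul_dslope, h0, sub_zero]
  have hb : ∀ z ∈ disk, ‖dslope w 0 z‖ ≤ 1 := fun z hz => by
    have := Complex.norm_dslope_le_div_of_mapsTo_ball (R₂ := 1) hw
      (by rw [h0]; exact hm.mono_right ball_subset_closedBall) hz
    simpa using this
  calc majorant w (ENNReal.ofReal r)
      = ENNReal.ofReal r * majorant (dslope w 0) (ENNReal.ofReal r) := by
        rw [← majorant_id_mul (analyticAt_zero hd), ← heq]
    _ ≤ ENNReal.ofReal r * 1 := by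
        gcongr
        exact majorant_le_one_of_norm_le_one hd hb hr0 hr
    _ = ENNReal.ofReal r := mul_one _

/-! ### The exponential integral -/

/-- The entire function `(e ^ z - 1) / z`. -/
def expSlope : ℂ → ℂ := dslope Complex.exp 0

lemma differentiable_expSlope : Differentiable ℂ expSlope :=
  differentiableOn_univ.mp
    ((Complex.differentiableOn_dslope univ_mem).mpr Complex.differentiable_exp.differentiableOn)

lemma exists_primitive_expSlope :
    ∃ g : ℂ → ℂ, g 0 = 0 ∧ ∀ z ∈ univ, HasDerivAt g (expSlope z) z :=
  differentiable_expSlope.isExactOn_univ.with_val_at 0 0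

/-- The entire exponential integral `∑_{n ≥ 1} z ^ n / (n * n!)`. -/
def expIntegral : ℂ → ℂ := Classical.choose exists_primitive_expSlope

lemma expIntegral_zero : expIntegral 0 = 0 := (Classical.choose_spec exists_primitive_expSlope).1

lemma hasDerivAt_expIntegral (z : ℂ) : HasDerivAt expIntegral (expSlope z) z :=
  (Classical.choose_spec exists_primitive_expSlope).2 z (mem_univ z)

/-- The real function `(e ^ x - 1) / x`, with value `1` at the origin. -/
def realExpSlope (x : ℝ) : ℝ := if x = 0 then 1 else (Real.exp x - 1) / x

lemma expSlope_zero : expSlope 0 = 1 := by simp [expSlope]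

lemma expSlope_ofReal (x : ℝ) : expSlope x = (realExpSlope x : ℂ) := by
  by_cases h : x = 0
  · simp [h, realExpSlope, expSlope_zero]
  · have h' : (x : ℂ) ≠ 0 := by exact_mod_cast h
    rw [expSlope, dslope_of_ne _ h', slope_def_field]
    simp [realExpSlope, h]

lemma mul_realExpSlope (x : ℝ) : x * realExpSlope x = Real.exp x - 1 := by
  by_cases h : x = 0
  · simp [h]
  · simp only [realExpSlope, h, if_false]
    field_simp

lemma realExpSlope_pos (x : ℝ) : 0 < realExpSlope x := by
  rcases lt_trichotomy x 0 with h | h | h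
  · rw [realExpSlope, if_neg h.ne]
    exact div_pos_of_neg_of_neg (by linarith [Real.exp_lt_exp.mpr h, Real.exp_zero]) h
  · simp [realExpSlope, h]
  · rw [realExpSlope, if_neg h.ne']
    exact div_pos (by linarith [Real.one_lt_exp_iff.mpr h]) h

/-- The restriction of `expIntegral` to the real axis. -/
def realExpIntegral (x : ℝ) : ℝ := (expIntegral x).re

lemma realExpIntegral_zero : realExpIntegral 0 = 0 := by
  simp [realExpIntegral, expIntegral_zero]

lemma hasDerivAt_realExpIntegral (x : ℝ) :
    HasDerivAt realExpIntegral (realExpSlope x) x := by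
  have h := (hasDerivAt_expIntegral (x : ℂ)).real_of_complex
  rwa [expSlope_ofReal, Complex.ofReal_re] at h

lemma continuous_realExpIntegral : Continuous realExpIntegral :=
  continuous_iff_continuousAt.mpr fun x => (hasDerivAt_realExpIntegral x).continuousAt

lemma expIntegral_ofReal (x : ℝ) : expIntegral x = (realExpIntegral x : ℂ) := by
  have hd : ∀ y : ℝ, HasDerivAt (fun y : ℝ => expIntegral y - (realExpIntegral y : ℂ)) 0 y := by
    intro y
    have h1 := (hasDerivAt_expIntegral (y : ℂ)).comp_ofReal
    have h2 := (hasDerivAt_realExpIntegral y).ofReal_comp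
    rw [expSlope_ofReal] at h1
    have h := h1.sub h2
    rw [sub_self] at h
    exact h
  have h := is_const_of_deriv_eq_zero (fun y => (hd y).differentiableAt)
    (fun y => (hd y).deriv) x 0
  simp only [Complex.ofReal_zero, expIntegral_zero, realExpIntegral_zero, sub_zero] at h
  exact sub_eq_zero.mp h

lemma strictMono_realExpIntegral : StrictMono realExpIntegral :=
  strictMono_of_hasDerivAt_pos hasDerivAt_realExpIntegral realExpSlope_pos

/-! ### The numerical estimate -/

/-- The Taylor polynomial of `expIntegral` of degree eight. -/
def expIntegralPoly (x : ℝ) : ℝ :=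
  x + x ^ 2 / 4 + x ^ 3 / 18 + x ^ 4 / 96 + x ^ 5 / 600 + x ^ 6 / 4320 + x ^ 7 / 35280 +
    x ^ 8 / 322560

/-- The derivative of `expIntegralPoly`. -/
def expSlopePoly (x : ℝ) : ℝ :=
  1 + x / 2 + x ^ 2 / 6 + x ^ 3 / 24 + x ^ 4 / 120 + x ^ 5 / 720 + x ^ 6 / 5040 + x ^ 7 / 40320

lemma hasDerivAt_expIntegralPoly (x : ℝ) : HasDerivAt expIntegralPoly (expSlopePoly x) x := by
  have h := ((((((((hasDerivAt_id' x).add ((hasDerivAt_pow 2 x).div_const 4)).add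
    ((hasDerivAt_pow 3 x).div_const 18)).add ((hasDerivAt_pow 4 x).div_const 96)).add
    ((hasDerivAt_pow 5 x).div_const 600)).add ((hasDerivAt_pow 6 x).div_const 4320)).add
    ((hasDerivAt_pow 7 x).div_const 35280)).add ((hasDerivAt_pow 8 x).div_const 322560))
  refine h.congr_deriv ?_
  rw [expSlopePoly]
  norm_num
  ring

lemma expSlopePoly_le {x : ℝ} (hx : -1 ≤ x) (hx' : x ≤ 1) : expSlopePoly x ≤ realExpSlope x := by
  rcases lt_trichotomy x 0 with h | h | h
  · rw [realExpSlope, if_neg h.ne, le_div_iff_of_neg h]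
    have hb := (abs_le.mp (Real.exp_bound (abs_le.mpr ⟨hx, hx'⟩) (n := 10) (by norm_num))).2
    norm_num [Finset.sum_range_succ, Nat.factorial] at hb
    rw [abs_of_neg h] at hb
    rw [expSlopePoly]
    -- For `x < 0` an upper bound on `e ^ x` is needed; the negative term `x ^ 9 / 9!` outweighs the
    -- remainder of order ten since `|x| ≤ 1`.
    have h9 : 0 ≤ (-x) ^ 9 := by have : 0 ≤ -x := by linarith
                                 positivity
    nlinarith [mul_nonneg h9 (by linarith : 0 ≤ 1 + x)]
  · simp [realExpSlope, h, expSlopePoly]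
  · rw [realExpSlope, if_neg h.ne', le_div_iff₀ h]
    have hb := Real.sum_le_exp_of_nonneg h.le 9
    norm_num [Finset.sum_range_succ, Nat.factorial] at hb
    rw [expSlopePoly]
    nlinarith

lemma expIntegralPoly_sub_le :
    expIntegralPoly (1 / 3) - expIntegralPoly (-1) ≤
      realExpIntegral (1 / 3) - realExpIntegral (-1) := by
  have hd : ∀ x, HasDerivAt (fun x => realExpIntegral x - expIntegralPoly x)
      (realExpSlope x - expSlopePoly x) x :=
    fun x => (hasDerivAt_realExpIntegral x).sub (hasDerivAt_expIntegralPoly x)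
  have hm : MonotoneOn (fun x => realExpIntegral x - expIntegralPoly x) (Icc (-1) (1 / 3)) := by
    refine monotoneOn_of_hasDerivWithinAt_nonneg (convex_Icc _ _)
      (fun x _ => (hd x).continuousAt.continuousWithinAt)
      (fun x _ => (hd x).hasDerivWithinAt) fun x hx => ?_
    rw [interior_Icc] at hx
    exact sub_nonneg.mpr (expSlopePoly_le hx.1.le (by linarith [hx.2]))
  have := hm (left_mem_Icc.mpr (by norm_num)) (right_mem_Icc.mpr (by norm_num)) (by norm_num)
  simp only at this
  linarith

/-- The value `1.159903` bounds the increment of the Taylor polynomial from below, and `1.098613`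
lies just above `log 3 = 1.0986122...`; the range of `α` is what their quotient permits. -/
lemma three_lt_exp_mul {α : ℝ} (hα₁ : α < 0.05284) :
    3 < Real.exp ((1 - α) * (realExpIntegral (1 / 3) - realExpIntegral (-1))) := by
  have h1 : (1.159903 : ℝ) ≤ realExpIntegral (1 / 3) - realExpIntegral (-1) :=
    le_trans (by norm_num [expIntegralPoly]) expIntegralPoly_sub_le
  have h2 : (1.098613 : ℝ) ≤ (1 - α) * (realExpIntegral (1 / 3) - realExpIntegral (-1)) := by
    norm_num at hα₁ h1 ⊢
    nlinarith
  refine lt_of_lt_of_le ?_ (Real.exp_le_exp.mpr h2)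
  refine lt_of_lt_of_le ?_ (Real.sum_le_exp_of_nonneg (by norm_num) 14)
  norm_num [Finset.sum_range_succ, Nat.factorial]

/-! ### Real part of the exponential on the unit disk -/

/-- On the circle of radius `ρ` the real part is even in the argument `t` and has derivative `-ρ e ^
(ρ cos t) sin (t + ρ sin t)`. Since `ρ ≤ 1`, `t + ρ sin t ≤ t + sin (π - t) ≤ π` on `[0, π]`, so the
function decreases to its value at `t = π`. -/
lemma exp_neg_le_re_exp {w : ℂ} (hw : ‖w‖ ≤ 1) : Real.exp (-‖w‖) ≤ (Complex.exp w).re := by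
  set ρ := ‖w‖ with hρ
  have hρ0 : 0 ≤ ρ := norm_nonneg w
  have hd : ∀ t : ℝ, HasDerivAt (fun t => Real.exp (ρ * Real.cos t) * Real.cos (ρ * Real.sin t))
      (-(ρ * Real.exp (ρ * Real.cos t) * Real.sin (t + ρ * Real.sin t))) t := by
    intro t
    have h1 := ((Real.hasDerivAt_cos t).const_mul ρ).exp
    have h2 := ((Real.hasDerivAt_sin t).const_mul ρ).cos
    refine (h1.mul h2).congr_deriv ?_
    rw [Real.sin_add]
    ring
  have hanti : AntitoneOn (fun t => Real.exp (ρ * Real.cos t) * Real.cos (ρ * Real.sin t))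
      (Icc 0 Real.pi) := by
    refine antitoneOn_of_hasDerivWithinAt_nonpos (convex_Icc _ _)
      (fun x _ => (hd x).continuousAt.continuousWithinAt)
      (fun x _ => (hd x).hasDerivWithinAt) fun x hx => ?_
    rw [interior_Icc] at hx
    have hs : 0 ≤ Real.sin x := Real.sin_nonneg_of_nonneg_of_le_pi hx.1.le hx.2.le
    have hs' : Real.sin x ≤ Real.pi - x := by
      rw [← Real.sin_pi_sub]
      exact Real.sin_le (by linarith [hx.2])
    have h1 : 0 ≤ Real.sin (x + ρ * Real.sin x) := by
      refine Real.sin_nonneg_of_nonneg_of_le_pi ?_ ?_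
      · have := mul_nonneg hρ0 hs
        linarith [hx.1]
      · nlinarith
    have := Real.exp_pos (ρ * Real.cos x)
    have : 0 ≤ ρ * Real.exp (ρ * Real.cos x) * Real.sin (x + ρ * Real.sin x) := by positivity
    linarith
  have hmem : |w.arg| ∈ Icc 0 Real.pi := ⟨abs_nonneg _, Complex.abs_arg_le_pi w⟩
  have h := hanti hmem (right_mem_Icc.mpr Real.pi_pos.le) hmem.2
  have hre : ρ * Real.cos |w.arg| = w.re := by rw [Real.cos_abs, hρ, Complex.norm_mul_cos_arg]
  have him : Real.cos (ρ * Real.sin |w.arg|) = Real.cos w.im := by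
    rw [← Complex.norm_mul_sin_arg w, ← hρ]
    rcases abs_choice w.arg with h | h <;> simp [h]
  simp only [hre, him, Real.cos_pi, Real.sin_pi, mul_zero, Real.cos_zero, mul_one] at h
  rw [Complex.exp_re]
  simpa using h

/-! ### Exponential representation -/

lemma eq_id_mul_dslope {f : ℂ → ℂ} (hf0 : f 0 = 0) : f = fun z => z * dslope f 0 z := by
  ext z
  rw [id_mul_dslope, hf0, sub_zero]

/-- Two functions with the same derivative on the disk and the same value at `0` agree. -/
lemma eqOn_disk_of_hasDerivAt {f g f' : ℂ → ℂ} (hf : ∀ z ∈ disk, HasDerivAt f (f' z) z)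
    (hg : ∀ z ∈ disk, HasDerivAt g (f' z) z) (h0 : f 0 = g 0) {z : ℂ} (hz : z ∈ disk) :
    f z = g z := by
  have hd : ∀ z ∈ disk, HasDerivAt (fun z => f z - g z) 0 z := fun z hz => by
    have h := (hf z hz).sub (hg z hz)
    rw [sub_self] at h
    exact h
  have h := isOpen_disk.is_const_of_deriv_eq_zero
    (convex_ball (0 : ℂ) 1).isPreconnected
    (fun z hz => (hd z hz).differentiableAt.differentiableWithinAt)
    (fun z hz => (hd z hz).deriv) hz zero_mem_disk
  simp only [h0, sub_self] at h
  exact sub_eq_zero.mp h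

/-- A normalized univalent function is `z * exp g` where `g' = (z f' / f - 1) / z`. -/
lemma exists_eq_mul_exp {f p : ℂ → ℂ} (hf : f ∈ Univalent) (hp : DifferentiableOn ℂ p disk)
    (hfp : ∀ z ∈ disk, starQuotient f z = p z) :
    ∃ g : ℂ → ℂ, g 0 = 0 ∧ (∀ z ∈ disk, HasDerivAt g (dslope p 0 z) z) ∧
      ∀ z ∈ disk, f z = z * Complex.exp (g z) := by
  obtain ⟨hfd, hinj, hf0, hf1⟩ := hf
  have hp0 : p 0 = 1 := by rw [← hfp 0 zero_mem_disk, starQuotient, if_pos rfl]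
  have hqd := differentiableOn_dslope_disk hp
  have hDd := differentiableOn_dslope_disk hfd
  obtain ⟨g, hg0, hg⟩ := hqd.isExactOn_ball.with_val_at 0 0
  refine ⟨g, hg0, hg, ?_⟩
  have hderiv_ne : ∀ z ∈ disk, z ≠ 0 →
      deriv (dslope f 0) z - dslope f 0 z * dslope p 0 z = 0 := by
    intro z hz hz0
    have hfz : f z ≠ 0 := fun h => hz0 (hinj hz zero_mem_disk (h.trans hf0.symm))
    have hD := (hDd.differentiableAt (isOpen_disk.mem_nhds hz)).hasDerivAt
    have h1 : deriv f z = 1 * dslope f 0 z + z * deriv (dslope f 0) z := by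
      conv_lhs => rw [eq_id_mul_dslope hf0]
      exact ((hasDerivAt_id' z).mul hD).deriv
    have h2 := hfp z hz
    rw [starQuotient, if_neg hz0, div_eq_iff hfz, h1] at h2
    have h3 := id_mul_dslope p z
    have h4 := id_mul_dslope f z
    rw [hp0] at h3
    rw [hf0, sub_zero] at h4
    rw [← h4] at h2
    have h5 : z * z * (deriv (dslope f 0) z - dslope f 0 z * dslope p 0 z) = 0 := by
      linear_combination h2 - z * dslope f 0 z * h3
    exact (mul_eq_zero.mp h5).resolve_left (mul_ne_zero hz0 hz0)
  have hderiv : ∀ z ∈ disk, deriv (dslope f 0) z = dslope f 0 z * dslope p 0 z := by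
    intro z hz
    refine sub_eq_zero.mp ?_
    by_cases hz0 : z = 0
    · subst hz0
      -- Cancelling `z * z` fails at the origin; the identity extends there by continuity.
      have hc : ContinuousAt
          (fun z => deriv (dslope f 0) z - dslope f 0 z * dslope p 0 z) 0 :=
        ((hDd.deriv isOpen_disk).continuousOn.continuousAt disk_mem_nhds_zero).sub
          ((hDd.continuousOn.continuousAt disk_mem_nhds_zero).mul
            (hqd.continuousOn.continuousAt disk_mem_nhds_zero))
      refine tendsto_nhds_unique (hc.tendsto.mono_left (nhdsWithin_le_nhds (s := {0}ᶜ))) ?_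
      refine tendsto_const_nhds.congr' ?_
      filter_upwards [self_mem_nhdsWithin, nhdsWithin_le_nhds disk_mem_nhds_zero] with z h1 h2
      exact (hderiv_ne z h2 h1).symm
    · exact hderiv_ne z hz hz0
  intro z hz
  have hconst : dslope f 0 z * Complex.exp (-g z) = 1 := by
    refine eqOn_disk_of_hasDerivAt (f := fun z => dslope f 0 z * Complex.exp (-g z))
      (g := fun _ => 1) (f' := fun _ => 0) (fun w hw => ?_) (fun w _ => hasDerivAt_const w 1) ?_ hz
    · have hD := (hDd.differentiableAt (isOpen_disk.mem_nhds hw)).hasDerivAt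
      refine (hD.mul (hg w hw).neg.cexp).congr_deriv ?_
      rw [hderiv w hw]
      simp only [Pi.neg_apply]
      ring
    · simp [hg0, hf1]
  have h4 := id_mul_dslope f z
  rw [hf0, sub_zero] at h4
  rw [← h4]
  rw [Complex.exp_neg, ← div_eq_mul_inv, div_eq_one_iff_eq (Complex.exp_ne_zero _)] at hconst
  rw [hconst]

lemma sum_le_of_majorant_le {f : ℂ → ℂ} {r x : ℝ} (hr : 0 ≤ r) (hx : 0 ≤ x)
    (h : majorant f (ENNReal.ofReal r) ≤ ENNReal.ofReal x) (N : ℕ) :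
    ∑ n ∈ Finset.range N, ‖taylorCoeff f n‖ * r ^ n ≤ x := by
  rw [← ENNReal.ofReal_le_ofReal_iff hx,
    ENNReal.ofReal_sum_of_nonneg fun n _ => by positivity]
  refine le_trans ?_ ((ENNReal.sum_le_tsum (Finset.range N)).trans h)
  refine Finset.sum_le_sum fun n _ => ?_
  rw [ENNReal.ofReal_mul (norm_nonneg _), ENNReal.ofReal_pow hr, ofReal_norm]

lemma majorant_le_of_sum_le {f : ℂ → ℂ} {r x : ℝ} (hr : 0 ≤ r)
    (h : ∀ N, ∑ n ∈ Finset.range N, ‖taylorCoeff f n‖ * r ^ n ≤ x) :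
    majorant f (ENNReal.ofReal r) ≤ ENNReal.ofReal x := by
  refine ENNReal.tsum_le_of_sum_range_le fun N => ?_
  refine le_trans (le_of_eq ?_) (ENNReal.ofReal_le_ofReal (h N))
  rw [ENNReal.ofReal_sum_of_nonneg fun n _ => by positivity]
  refine Finset.sum_congr rfl fun n _ => ?_
  rw [ENNReal.ofReal_mul (norm_nonneg _), ENNReal.ofReal_pow hr, ofReal_norm]

/-! ### Majorant and growth estimates in the class -/

/-- The Koebe-type function of `expFun α` on the real axis. -/
def koebeReal (α x : ℝ) : ℝ := x * Real.exp ((1 - α) * realExpIntegral x)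

lemma differentiable_expFun (α : ℝ) : Differentiable ℂ (expFun α) :=
  (Complex.differentiable_exp.const_mul _).const_add _

section Class

variable {α : ℝ} {f w : ℂ → ℂ}

lemma differentiableOn_expFun_comp (hw : DifferentiableOn ℂ w disk) :
    DifferentiableOn ℂ (fun z => expFun α (w z)) disk :=
  (differentiable_expFun α).comp_differentiableOn hw

lemma taylorCoeff_dslope_expFun_comp (hw : DifferentiableOn ℂ w disk) (n : ℕ) :
    taylorCoeff (dslope (fun z => expFun α (w z)) 0) n =
      (1 - α) * taylorCoeff (fun z => Complex.exp (w z)) (n + 1) := by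
  have hp := differentiableOn_expFun_comp (α := α) hw
  have hq := analyticAt_zero (differentiableOn_dslope_disk hp)
  rw [← taylorCoeff_id_mul_succ hq]
  have h1 : (fun z => z * dslope (fun z => expFun α (w z)) 0 z) =
      fun z => (α - expFun α (w 0)) + (1 - α) * Complex.exp (w z) := by
    ext z
    rw [id_mul_dslope]
    simp only [expFun]
    ring
  rw [h1, taylorCoeff_add (f := fun _ => α - expFun α (w 0))
    (g := fun z => (1 - α) * Complex.exp (w z)) analyticAt_const
    (analyticAt_const.mul (analyticAt_zero hw).cexp), taylorCoeff_const_succ,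
    taylorCoeff_const_mul, zero_add]

/-- Removing the constant term `1` from the bound `e ^ t` for the majorant of `e ^ ω` and dividing
by `t` leaves `(e ^ t - 1) / t`. Finite sums are kept so that the bound can be integrated term by
term. -/
lemma sum_dslope_expFun_comp_le (hα : α ≤ 1) (hw : DifferentiableOn ℂ w disk)
    (hm : MapsTo w disk disk) (h0 : w 0 = 0) {t : ℝ} (ht0 : 0 < t) (ht : t ≤ 1 / 3) (N : ℕ) :
    ∑ n ∈ Finset.range N, ‖taylorCoeff (dslope (fun z => expFun α (w z)) 0) n‖ * t ^ n ≤
      (1 - α) * realExpSlope t := by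
  have h1 := sum_le_of_majorant_le ht0.le (Real.exp_pos t).le
    (majorant_exp_comp_le (analyticAt_zero hw) h0 ht0.le
      (majorant_schwarz_le hw hm h0 ht0.le ht)) (N + 1)
  rw [Finset.sum_range_succ', taylorCoeff_zero, h0, Complex.exp_zero] at h1
  simp only [norm_one, pow_zero, mul_one] at h1
  have hα' : ‖(1 - α : ℂ)‖ = 1 - α := by
    rw [← Complex.ofReal_one, ← Complex.ofReal_sub, Complex.norm_real, Real.norm_eq_abs,
      abs_of_nonneg (by linarith)]
  have h2 : t * ∑ n ∈ Finset.range N,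
      ‖taylorCoeff (dslope (fun z => expFun α (w z)) 0) n‖ * t ^ n =
      (1 - α) * ∑ n ∈ Finset.range N,
        ‖taylorCoeff (fun z => Complex.exp (w z)) (n + 1)‖ * t ^ (n + 1) := by
    rw [Finset.mul_sum, Finset.mul_sum]
    refine Finset.sum_congr rfl fun n _ => ?_
    rw [taylorCoeff_dslope_expFun_comp hw, norm_mul, hα']
    ring
  refine le_of_mul_le_mul_left ?_ ht0
  rw [h2, mul_left_comm, mul_realExpSlope]
  exact mul_le_mul_of_nonneg_left (by linarith) (by linarith)

/-- The bound of `sum_dslope_expFun_comp_le` is integrated from `0` to `r`: the difference of the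
two primitives is monotone and vanishes at `0`. -/
lemma majorant_primitive_le (hα : α ≤ 1) (hw : DifferentiableOn ℂ w disk)
    (hm : MapsTo w disk disk) (h0 : w 0 = 0) {g : ℂ → ℂ} (hg0 : g 0 = 0)
    (hg : ∀ z ∈ disk, HasDerivAt g (dslope (fun z => expFun α (w z)) 0 z) z)
    {r : ℝ} (hr0 : 0 ≤ r) (hr : r ≤ 1 / 3) :
    majorant g (ENNReal.ofReal r) ≤ ENNReal.ofReal ((1 - α) * realExpIntegral r) := by
  have hcoeff : ∀ n, ‖taylorCoeff g (n + 1)‖ =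
      ‖taylorCoeff (dslope (fun z => expFun α (w z)) 0) n‖ / (n + 1) := by
    intro n
    have hev : deriv g =ᶠ[𝓝 0] dslope (fun z => expFun α (w z)) 0 := by
      filter_upwards [disk_mem_nhds_zero] with z hz using (hg z hz).deriv
    have hn : (0 : ℝ) < n + 1 := by positivity
    have hn' : ‖(n + 1 : ℂ)‖ = n + 1 := by exact_mod_cast Complex.norm_natCast (n + 1)
    rw [← taylorCoeff_congr hev, taylorCoeff_deriv, norm_mul, hn']
    field_simp
  refine majorant_le_of_sum_le hr0 fun N => ?_
  refine (Finset.sum_le_sum_of_subset_of_nonneg (Finset.range_subset_range.mpr N.le_succ)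
    fun n _ _ => by positivity).trans ?_
  rw [Finset.sum_range_succ', taylorCoeff_zero, hg0, norm_zero, zero_mul, add_zero]
  simp only [hcoeff]
  have hd : ∀ t : ℝ, HasDerivAt (fun t : ℝ => (1 - α) * realExpIntegral t -
      ∑ n ∈ Finset.range N, ‖taylorCoeff (dslope (fun z => expFun α (w z)) 0) n‖ / (n + 1) *
        t ^ (n + 1)) ((1 - α) * realExpSlope t - ∑ n ∈ Finset.range N,
        ‖taylorCoeff (dslope (fun z => expFun α (w z)) 0) n‖ * t ^ n) t := by
    intro t
    refine ((hasDerivAt_realExpIntegral t).const_mul (1 - α)).sub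
      (HasDerivAt.fun_sum fun n _ => ?_)
    refine ((hasDerivAt_pow (n + 1) t).const_mul _).congr_deriv ?_
    have hn : (n + 1 : ℝ) ≠ 0 := by positivity
    rw [Nat.add_sub_cancel]
    push_cast
    field_simp
  have hmono : MonotoneOn (fun t : ℝ => (1 - α) * realExpIntegral t -
      ∑ n ∈ Finset.range N, ‖taylorCoeff (dslope (fun z => expFun α (w z)) 0) n‖ / (n + 1) *
        t ^ (n + 1)) (Icc 0 r) := by
    refine monotoneOn_of_hasDerivWithinAt_nonneg (convex_Icc _ _)
      (fun x _ => (hd x).continuousAt.continuousWithinAt)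
      (fun x _ => (hd x).hasDerivWithinAt) fun x hx => ?_
    rw [interior_Icc] at hx
    exact sub_nonneg.mpr (sum_dslope_expFun_comp_le hα hw hm h0 hx.1 (by linarith [hx.2]) N)
  have h := hmono (left_mem_Icc.mpr hr0) (right_mem_Icc.mpr hr0) hr0
  simp only [realExpIntegral_zero, mul_zero, zero_pow (Nat.succ_ne_zero _),
    Finset.sum_const_zero, sub_zero] at h
  linarith

lemma realExpIntegral_nonneg {r : ℝ} (hr : 0 ≤ r) : 0 ≤ realExpIntegral r := by
  rw [← realExpIntegral_zero]
  exact strictMono_realExpIntegral.monotone hr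

/-- Coefficient majorization in the class: `∑ |a_n| r ^ n ≤ h r` for `r ≤ 1 / 3`. -/
lemma majorant_le_koebeReal (hα : α ≤ 1) (hf : f ∈ maMindaStarlike (expFun α))
    {r : ℝ} (hr0 : 0 ≤ r) (hr : r ≤ 1 / 3) :
    majorant f (ENNReal.ofReal r) ≤ ENNReal.ofReal (koebeReal α r) := by
  obtain ⟨hfu, w, hw, hm, h0, hfw⟩ := hf
  obtain ⟨g, hg0, hg, hfg⟩ := exists_eq_mul_exp hfu (differentiableOn_expFun_comp hw) hfw
  have hgd : DifferentiableOn ℂ g disk :=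
    fun z hz => (hg z hz).differentiableAt.differentiableWithinAt
  have hga := analyticAt_zero hgd
  have hev : f =ᶠ[𝓝 0] fun z => z * Complex.exp (g z) := by
    filter_upwards [disk_mem_nhds_zero] with z hz using hfg z hz
  rw [majorant_congr hev, majorant_id_mul (f := fun z => Complex.exp (g z)) hga.cexp, koebeReal,
    ENNReal.ofReal_mul hr0]
  gcongr
  exact majorant_exp_comp_le hga hg0
    (mul_nonneg (by linarith) (realExpIntegral_nonneg hr0))
    (majorant_primitive_le hα hw hm h0 hg0 hg hr0 hr)

/-- The growth theorem in the class: `- h (-|z|) ≤ |f z|`. -/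
lemma neg_koebeReal_le_norm (hα : α ≤ 1) (hf : f ∈ maMindaStarlike (expFun α))
    {z : ℂ} (hz : z ∈ disk) : -koebeReal α (-‖z‖) ≤ ‖f z‖ := by
  obtain ⟨hfu, w, hw, hm, h0, hfw⟩ := hf
  obtain ⟨g, hg0, hg, hfg⟩ := exists_eq_mul_exp hfu (differentiableOn_expFun_comp hw) hfw
  have hz1 : ‖z‖ < 1 := mem_disk.mp hz
  have hmem : ∀ t ∈ Icc (0 : ℝ) 1, (t : ℂ) * z ∈ disk := fun t ht => by
    rw [mem_disk, norm_mul, Complex.norm_real, Real.norm_eq_abs, abs_of_nonneg ht.1]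
    exact (mul_le_of_le_one_left (norm_nonneg z) ht.2).trans_lt hz1
  -- `Re g` is the logarithm of `|f z / z|`; it is compared along the ray through `z` with the same
  -- quantity for `h` on the negative axis.
  have hd : ∀ t ∈ Icc (0 : ℝ) 1, HasDerivAt
      (fun t : ℝ => (g (t * z)).re - (1 - α) * realExpIntegral (-(t * ‖z‖)))
      ((dslope (fun z => expFun α (w z)) 0 (t * z) * z).re -
        (1 - α) * (realExpSlope (-(t * ‖z‖)) * -‖z‖)) t := by
    intro t ht
    have h1 : HasDerivAt (fun s : ℂ => g (s * z))
        (dslope (fun z => expFun α (w z)) 0 (t * z) * z) (t : ℂ) := by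
      have := (hg _ (hmem t ht)).comp (t : ℂ) ((hasDerivAt_id' (t : ℂ)).mul_const z)
      rwa [one_mul] at this
    have h2 : HasDerivAt (fun s : ℝ => realExpIntegral (-(s * ‖z‖)))
        (realExpSlope (-(t * ‖z‖)) * -‖z‖) t := by
      have := (hasDerivAt_realExpIntegral (-(t * ‖z‖))).comp t
        ((hasDerivAt_id' t).mul_const ‖z‖).neg
      rwa [one_mul] at this
    exact h1.real_of_complex.sub (h2.const_mul (1 - α))
  have hmono : MonotoneOn
      (fun t : ℝ => (g (t * z)).re - (1 - α) * realExpIntegral (-(t * ‖z‖))) (Icc 0 1) := by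
    refine monotoneOn_of_hasDerivWithinAt_nonneg (convex_Icc _ _)
      (fun x hx => (hd x hx).continuousAt.continuousWithinAt)
      (fun x hx => (hd x (interior_subset hx)).hasDerivWithinAt) fun t ht => ?_
    have htI := interior_subset ht
    rw [interior_Icc] at ht
    have hwz : ‖w (t * z)‖ ≤ t * ‖z‖ := by
      have := Complex.norm_le_norm_of_mapsTo_ball (R := 1) hw
        (hm.mono_right ball_subset_closedBall) h0 (mem_disk.mp (hmem t htI))
      rwa [norm_mul, Complex.norm_real, Real.norm_eq_abs, abs_of_pos ht.1] at this
    have hre : Real.exp (-(t * ‖z‖)) ≤ (Complex.exp (w (t * z))).re :=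
      (Real.exp_le_exp.mpr (neg_le_neg hwz)).trans
        (exp_neg_le_re_exp (mem_disk.mp (hm (hmem t htI))).le)
    have h1 : t * (dslope (fun z => expFun α (w z)) 0 (t * z) * z).re =
        (1 - α) * ((Complex.exp (w (t * z))).re - 1) := by
      have h := id_mul_dslope (fun z => expFun α (w z)) (t * z)
      have h' := congrArg Complex.re h
      rw [mul_assoc, Complex.re_ofReal_mul, mul_comm z] at h'
      rw [h']
      simp only [expFun, h0, Complex.exp_zero]
      rw [← Complex.ofReal_one, ← Complex.ofReal_sub, Complex.sub_re, Complex.add_re,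
        Complex.re_ofReal_mul]
      simp
      ring
    have h2 := mul_realExpSlope (-(t * ‖z‖))
    -- After multiplication by `t` the derivative becomes `(1 - α) * (Re e ^ ω - e ^ (-t|z|))`,
    -- nonnegative by the Schwarz lemma and `exp_neg_le_re_exp`.
    refine nonneg_of_mul_nonneg_right ?_ ht.1
    have h3 : t * ((dslope (fun z => expFun α (w z)) 0 (t * z) * z).re -
        (1 - α) * (realExpSlope (-(t * ‖z‖)) * -‖z‖)) =
        (1 - α) * ((Complex.exp (w (t * z))).re - Real.exp (-(t * ‖z‖))) := by
      linear_combination h1 - (1 - α) * h2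
    rw [h3]
    exact mul_nonneg (by linarith) (by linarith)
  have h := hmono (left_mem_Icc.mpr zero_le_one) (right_mem_Icc.mpr zero_le_one) zero_le_one
  simp only [Complex.ofReal_zero, zero_mul, hg0, neg_zero, realExpIntegral_zero, mul_zero,
    Complex.zero_re, sub_zero, Complex.ofReal_one, one_mul] at h
  rw [hfg z hz, norm_mul, Complex.norm_exp, koebeReal, neg_mul, neg_neg]
  gcongr
  linarith

end Class

/-! ### The extremal function: uniqueness, existence, univalence -/

lemma dslope_expFun (α : ℝ) (z : ℂ) : dslope (expFun α) 0 z = (1 - α) * expSlope z := by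
  by_cases hz : z = 0
  · subst hz
    have h : HasDerivAt (expFun α) ((1 - α) * Complex.exp 0) 0 :=
      ((Complex.hasDerivAt_exp 0).const_mul _).const_add _
    rw [dslope_same, h.deriv, expSlope_zero, Complex.exp_zero]
  · rw [expSlope, dslope_of_ne _ hz, dslope_of_ne _ hz, slope_def_field, slope_def_field]
    simp only [expFun]
    ring

lemma IsKoebeFunction.eq_mul_exp {α : ℝ} {h : ℂ → ℂ} (hh : IsKoebeFunction (expFun α) h) {z : ℂ}
    (hz : z ∈ disk) : h z = z * Complex.exp ((1 - α) * expIntegral z) := by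
  obtain ⟨g, hg0, hg, hhg⟩ :=
    exists_eq_mul_exp hh.1 (differentiable_expFun α).differentiableOn hh.2
  have hgz : g z = (1 - α) * expIntegral z := by
    refine eqOn_disk_of_hasDerivAt (g := fun z => (1 - α) * expIntegral z) hg (fun w _ => ?_)
      (by simp [hg0, expIntegral_zero]) hz
    rw [dslope_expFun]
    exact (hasDerivAt_expIntegral w).const_mul _
  rw [hhg z hz, hgz]

lemma IsKoebeFunction.ofReal {α : ℝ} {h : ℂ → ℂ} (hh : IsKoebeFunction (expFun α) h) {x : ℝ}
    (hx : |x| < 1) : h x = (koebeReal α x : ℂ) := by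
  rw [hh.eq_mul_exp (by rw [mem_disk, Complex.norm_real]; exact hx), expIntegral_ofReal, koebeReal]
  push_cast
  rfl

lemma IsKoebeFunction.mem_maMindaStarlike {α : ℝ} {h : ℂ → ℂ}
    (hh : IsKoebeFunction (expFun α) h) : h ∈ maMindaStarlike (expFun α) :=
  ⟨hh.1, id, differentiableOn_id, mapsTo_id _, rfl, hh.2⟩

/-- The Noshiro–Warschawski criterion. -/
lemma injOn_of_re_deriv_pos {s : Set ℂ} (hs : Convex ℝ s) {F F' : ℂ → ℂ}
    (hF : ∀ z ∈ s, HasDerivAt F (F' z) z) (hpos : ∀ z ∈ s, 0 < (F' z).re) : InjOn F s := by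
  intro a ha b hb hab
  by_contra hne
  have hmem : ∀ t ∈ Icc (0 : ℝ) 1, a + (t : ℂ) * (b - a) ∈ s := fun t ht => by
    have := hs.add_smul_sub_mem ha hb ht
    rwa [Complex.real_smul] at this
  -- Multiplying by the conjugate of `b - a` turns the derivative along the segment into `F' * |b -
  -- a| ^ 2`, whose real part is positive.
  have hd : ∀ t ∈ Icc (0 : ℝ) 1, HasDerivAt
      (fun t : ℝ => (F (a + t * (b - a)) * (starRingEnd ℂ) (b - a)).re)
      (F' (a + t * (b - a)) * (b - a) * (starRingEnd ℂ) (b - a)).re t := by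
    intro t ht
    have h1 : HasDerivAt (fun s : ℂ => F (a + s * (b - a)) * (starRingEnd ℂ) (b - a))
        (F' (a + t * (b - a)) * (b - a) * (starRingEnd ℂ) (b - a)) (t : ℂ) := by
      have := (hF _ (hmem t ht)).comp (t : ℂ)
        (((hasDerivAt_id' (t : ℂ)).mul_const (b - a)).const_add a)
      rw [one_mul] at this
      exact this.mul_const _
    exact h1.real_of_complex
  have hmono : StrictMonoOn
      (fun t : ℝ => (F (a + t * (b - a)) * (starRingEnd ℂ) (b - a)).re) (Icc 0 1) := by
    refine strictMonoOn_of_hasDerivWithinAt_pos (convex_Icc _ _)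
      (fun x hx => (hd x hx).continuousAt.continuousWithinAt)
      (fun x hx => (hd x (interior_subset hx)).hasDerivWithinAt) fun t ht => ?_
    rw [mul_assoc, Complex.mul_conj, mul_comm, Complex.re_ofReal_mul]
    exact mul_pos (Complex.normSq_pos.mpr (sub_ne_zero.mpr (Ne.symm hne)))
      (hpos _ (hmem t (interior_subset ht)))
  have h := hmono (left_mem_Icc.mpr zero_le_one) (right_mem_Icc.mpr zero_le_one) zero_lt_one
  simp [hab] at h

lemma re_expFun_pos {α : ℝ} (hα₀ : 0 ≤ α) (hα₁ : α < 1) {z : ℂ} (hz : z ∈ disk) :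
    0 < (expFun α z).re := by
  have h1 := exp_neg_le_re_exp (mem_disk.mp hz).le
  have h2 := Real.exp_pos (-‖z‖)
  rw [expFun, ← Complex.ofReal_one, ← Complex.ofReal_sub, Complex.add_re, Complex.re_ofReal_mul,
    Complex.ofReal_re]
  have := mul_pos (sub_pos.mpr hα₁) (h2.trans_le h1)
  linarith

lemma mul_expSlope (z : ℂ) : z * expSlope z = Complex.exp z - 1 := by
  rw [expSlope, id_mul_dslope, Complex.exp_zero]

/-- The Koebe-type function of `expFun α`. -/
def koebe (α : ℝ) (z : ℂ) : ℂ := z * Complex.exp ((1 - α) * expIntegral z)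

lemma hasDerivAt_koebe (α : ℝ) (z : ℂ) :
    HasDerivAt (koebe α) (expFun α z * Complex.exp ((1 - α) * expIntegral z)) z := by
  refine ((hasDerivAt_id' z).mul
    ((hasDerivAt_expIntegral z).const_mul (1 - α : ℂ)).cexp).congr_deriv ?_
  rw [expFun]
  linear_combination (1 - α) * Complex.exp ((1 - α) * expIntegral z) * mul_expSlope z

/-- In the coordinate `z = e ^ ζ` the logarithm of `koebe α` is `ζ + (1 - α) * E (e ^ ζ)`, with
derivative `φ_α (e ^ ζ)` of positive real part on the convex left half-plane, so Noshiro–Warschawski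
applies. -/
lemma injOn_koebe {α : ℝ} (hα₀ : 0 ≤ α) (hα₁ : α < 1) : InjOn (koebe α) disk := by
  have hlog : InjOn (fun ζ : ℂ => ζ + (1 - α) * expIntegral (Complex.exp ζ)) {ζ | ζ.re < 0} := by
    refine injOn_of_re_deriv_pos (F' := fun ζ => expFun α (Complex.exp ζ))
      (convex_halfSpace_re_lt 0) (fun ζ _ => ?_) (fun ζ hζ => re_expFun_pos hα₀ hα₁ ?_)
    · refine ((hasDerivAt_id' ζ).add (((hasDerivAt_expIntegral _).comp ζ
        (Complex.hasDerivAt_exp ζ)).const_mul (1 - α : ℂ))).congr_deriv ?_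
      rw [expFun]
      linear_combination (1 - α : ℂ) * mul_expSlope (Complex.exp ζ)
    · rw [mem_disk, Complex.norm_exp]
      exact (Real.exp_lt_exp.mpr hζ).trans_eq Real.exp_zero
  have hzero : ∀ z, koebe α z = 0 → z = 0 := fun z h =>
    (mul_eq_zero.mp h).resolve_right (Complex.exp_ne_zero _)
  intro a ha b hb hab
  by_cases ha0 : a = 0
  · rw [ha0]
    refine (hzero b ?_).symm
    rw [← hab, ha0, koebe, zero_mul]
  have hb0 : b ≠ 0 := by
    rintro rfl
    exact ha0 (hzero a (by rw [hab, koebe, zero_mul]))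
  have hlogre : ∀ z ∈ disk, z ≠ 0 → (Complex.log z).re < 0 := fun z hz hz0 => by
    rw [Complex.log_re]
    exact Real.log_neg (norm_pos_iff.mpr hz0) (mem_disk.mp hz)
  have hexp : ∀ z : ℂ, z ≠ 0 →
      Complex.exp (Complex.log z + (1 - α) * expIntegral z) = koebe α z := fun z hz0 => by
    rw [Complex.exp_add, Complex.exp_log hz0, koebe]
  rw [← hexp a ha0, ← hexp b hb0, Complex.exp_eq_exp_iff_exists_int] at hab
  obtain ⟨n, hn⟩ := hab
  -- The multiple of `2πi` between the two logarithms is absorbed by choosing another logarithm of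
  -- `b`, still in the half-plane.
  have hper : Complex.exp (Complex.log b + n * (2 * Real.pi * Complex.I)) = b := by
    rw [Complex.exp_add, Complex.exp_log hb0, Complex.exp_int_mul_two_pi_mul_I, mul_one]
  have hmem : (Complex.log b + n * (2 * Real.pi * Complex.I)).re < 0 := by
    have h : (Complex.log b + n * (2 * Real.pi * Complex.I)).re = (Complex.log b).re := by simp
    rw [h]
    exact hlogre b hb hb0
  have h := hlog (hlogre a ha ha0) hmem (by
    simp only [hper, Complex.exp_log ha0]
    rw [hn]
    ring)
  rw [← Complex.exp_log ha0, h, hper]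

lemma isKoebeFunction_koebe {α : ℝ} (hα₀ : 0 ≤ α) (hα₁ : α < 1) :
    IsKoebeFunction (expFun α) (koebe α) := by
  refine ⟨⟨fun z _ => (hasDerivAt_koebe α z).differentiableAt.differentiableWithinAt,
    injOn_koebe hα₀ hα₁, by simp [koebe], ?_⟩, fun z _ => ?_⟩
  · rw [(hasDerivAt_koebe α 0).deriv]
    simp [expFun, expIntegral_zero]
  · by_cases hz : z = 0
    · simp [starQuotient, hz, expFun]
    · rw [starQuotient, if_neg hz, (hasDerivAt_koebe α z).deriv, koebe]
      field_simp

/-! ### Covering theorem and boundary points -/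

lemma isOpen_image {f : ℂ → ℂ} (hf : f ∈ Univalent) {s : Set ℂ} (hs : s ⊆ disk)
    (hso : IsOpen s) : IsOpen (f '' s) := by
  obtain ⟨hd, hinj, -, -⟩ := hf
  rcases (hd.analyticOnNhd isOpen_disk).is_constant_or_isOpen
    (convex_ball (0 : ℂ) 1).isPreconnected with ⟨c, hc⟩ | h
  · have hmem : (1 / 2 : ℂ) ∈ disk := by rw [mem_disk]; norm_num
    have := hinj hmem zero_mem_disk ((hc _ hmem).trans (hc _ zero_mem_disk).symm)
    norm_num at this
  · exact h s hs hso

lemma isOpen_image_disk {f : ℂ → ℂ} (hf : f ∈ Univalent) : IsOpen (f '' disk) :=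
  isOpen_image hf subset_rfl isOpen_disk

lemma neg_koebeReal_neg_one (α : ℝ) :
    -koebeReal α (-1) = Real.exp ((1 - α) * realExpIntegral (-1)) := by
  rw [koebeReal]; ring

/-- The covering theorem in the class. -/
lemma ofReal_le_infEDist_frontier {α : ℝ} (hα : α ≤ 1) {f : ℂ → ℂ}
    (hf : f ∈ maMindaStarlike (expFun α)) :
    ENNReal.ofReal (-koebeReal α (-1)) ≤ infEDist (f 0) (frontier (f '' disk)) := by
  have hfu := hf.1
  rw [le_infEDist]
  intro y hy
  rw [hfu.2.2.1, edist_comm, edist_zero_right, ← ofReal_norm]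
  refine ENNReal.ofReal_le_ofReal ?_
  rw [(isOpen_image_disk hfu).frontier_eq] at hy
  -- A frontier point is outside the compact image of `|z| ≤ r`, hence a limit of values from `r <
  -- |z| < 1`, where the growth theorem applies; then `r → 1`.
  have hr : ∀ r ∈ Ioo (0 : ℝ) 1, r * -koebeReal α (-1) ≤ ‖y‖ := by
    intro r hr
    have hsub : closedBall (0 : ℂ) r ⊆ disk := closedBall_subset_ball hr.2
    have hK : IsClosed (f '' closedBall 0 r) :=
      ((isCompact_closedBall 0 r).image_of_continuousOn (hfu.1.continuousOn.mono hsub)).isClosed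
    have hcl : y ∈ closure (f '' (disk \ closedBall 0 r)) := by
      have h := hy.1
      rw [← union_sdiff_cancel hsub, image_union, closure_union, hK.closure_eq] at h
      exact h.resolve_left fun h' => hy.2 (image_mono hsub h')
    have hclosed : IsClosed {v : ℂ | r * -koebeReal α (-1) ≤ ‖v‖} :=
      isClosed_le continuous_const continuous_norm
    refine closure_minimal ?_ hclosed hcl
    rintro _ ⟨z, ⟨hz, hzr⟩, rfl⟩
    refine le_trans ?_ (neg_koebeReal_le_norm hα hf hz)
    rw [mem_closedBall_zero_iff, not_le] at hzr
    rw [neg_koebeReal_neg_one, koebeReal, neg_mul, neg_neg]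
    have hz1 := mem_disk.mp hz
    have hmono := strictMono_realExpIntegral.monotone (neg_le_neg hz1.le)
    have : (1 - α) * realExpIntegral (-1) ≤ (1 - α) * realExpIntegral (-‖z‖) :=
      mul_le_mul_of_nonneg_left hmono (by linarith)
    gcongr
  have hlim : Tendsto (fun r : ℝ => r * -koebeReal α (-1)) (𝓝[<] 1)
      (𝓝 (1 * -koebeReal α (-1))) :=
    ((continuous_id.mul continuous_const).tendsto 1).mono_left nhdsWithin_le_nhds
  rw [one_mul] at hlim
  refine le_of_tendsto hlim ?_
  filter_upwards [Ioo_mem_nhdsLT (zero_lt_one' ℝ)] with r h using hr r h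

lemma continuous_koebeReal (α : ℝ) : Continuous (koebeReal α) :=
  continuous_id.mul (Real.continuous_exp.comp (continuous_const.mul continuous_realExpIntegral))

lemma IsKoebeFunction.tendsto_neg {α : ℝ} {h : ℂ → ℂ} (hh : IsKoebeFunction (expFun α) h) :
    Tendsto (fun r : ℝ => h (-(r : ℂ))) (𝓝[<] 1) (𝓝 (koebeReal α (-1) : ℂ)) := by
  have hc : Continuous fun r : ℝ => (koebeReal α (-r) : ℂ) :=
    Complex.continuous_ofReal.comp ((continuous_koebeReal α).comp continuous_neg)
  refine ((hc.tendsto 1).mono_left nhdsWithin_le_nhds).congr' ?_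
  filter_upwards [Ioo_mem_nhdsLT (zero_lt_one' ℝ)] with r hr
  rw [← Complex.ofReal_neg, hh.ofReal]
  rw [abs_neg, abs_of_pos hr.1]
  exact hr.2

/-- A radial limit of a univalent function is a boundary point of its image. -/
lemma mem_frontier_of_tendsto {f : ℂ → ℂ} (hf : f ∈ Univalent) {m : ℂ}
    (hm : Tendsto (fun r : ℝ => f (-(r : ℂ))) (𝓝[<] 1) (𝓝 m)) : m ∈ frontier (f '' disk) := by
  have hev : ∀ᶠ r : ℝ in 𝓝[<] 1, -(r : ℂ) ∈ disk ∧ ‖-(r : ℂ)‖ = r := by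
    filter_upwards [Ioo_mem_nhdsLT (zero_lt_one' ℝ)] with r hr
    have h : ‖-(r : ℂ)‖ = r := by
      rw [norm_neg, Complex.norm_real, Real.norm_eq_abs, abs_of_pos hr.1]
    exact ⟨mem_disk.mpr (h.trans_lt hr.2), h⟩
  rw [(isOpen_image_disk hf).frontier_eq]
  refine ⟨mem_closure_of_tendsto hm (hev.mono fun r hr => mem_image_of_mem f hr.1), ?_⟩
  rintro ⟨z₀, hz₀, rfl⟩
  -- If the limit were `f z₀`, the open set `f '' ball 0 s` would contain `f (-r)` for `r` near `1`,
  -- and injectivity would force `r < s`.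
  obtain ⟨s, hs, hs1⟩ := exists_between (mem_disk.mp hz₀)
  have hsub : ball (0 : ℂ) s ⊆ disk := ball_subset_ball hs1.le
  have hopen : IsOpen (f '' ball 0 s) := isOpen_image hf hsub isOpen_ball
  have h1 := hm.eventually
    (hopen.mem_nhds (mem_image_of_mem f (mem_ball_zero_iff.mpr hs)))
  have h2 : ∀ᶠ r : ℝ in 𝓝[<] 1, r ∈ Ioo s 1 := Ioo_mem_nhdsLT hs1
  obtain ⟨r, ⟨z, hz, hzr⟩, ⟨hrd, hrn⟩, hrs⟩ := (h1.and (hev.and h2)).exists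
  have heq := hf.2.1 (hsub hz) hrd hzr
  rw [heq, mem_ball_zero_iff, hrn] at hz
  exact absurd hz (not_lt.mpr hrs.1.le)

/-! ### The Bohr radius -/

lemma enorm_add_tsum_eq_majorant {f : ℂ → ℂ} (hf : f ∈ Univalent) (z : ℂ) :
    ‖z‖ₑ + ∑' n : ℕ, ‖taylorCoeff f (n + 2)‖ₑ * ‖z‖ₑ ^ (n + 2) = majorant f ‖z‖ₑ := by
  have h1 : taylorCoeff f 1 = 1 := by simp [taylorCoeff, hf.2.2.2]
  rw [majorant_eq_zero_add, hf.2.2.1, enorm_zero, zero_add,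
    tsum_eq_zero_add' (f := fun n => ‖taylorCoeff f (n + 1)‖ₑ * ‖z‖ₑ ^ (n + 1)) ENNReal.summable,
    zero_add, h1, enorm_one, one_mul, pow_one]

/-- Suffices for sharpness, so the signs of the Taylor coefficients of `h` never matter. -/
lemma enorm_le_majorant {f : ℂ → ℂ} (hf : DifferentiableOn ℂ f disk) {z : ℂ} (hz : z ∈ disk) :
    ‖f z‖ₑ ≤ majorant f ‖z‖ₑ := by
  rw [← (hasSum_taylorCoeff hf hz).tsum_eq, majorant]
  refine enorm_tsum_le_tsum_enorm.trans_eq (tsum_congr fun n => ?_)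
  rw [enorm_mul, enorm_pow]

lemma koebeReal_pos {α x : ℝ} (hx : 0 < x) : 0 < koebeReal α x := mul_pos hx (Real.exp_pos _)

lemma koebeReal_strictMonoOn {α : ℝ} (hα : α ≤ 1) : StrictMonoOn (koebeReal α) (Ici 0) := by
  intro x hx y hy hxy
  have h : (1 - α) * realExpIntegral x ≤ (1 - α) * realExpIntegral y :=
    mul_le_mul_of_nonneg_left (strictMono_realExpIntegral.monotone hxy.le) (by linarith)
  exact mul_lt_mul hxy (Real.exp_le_exp.mpr h) (Real.exp_pos _) hy

/-- The equation `h r + h (-1) = 0` has a root in `(0, 1 / 3)`. -/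
lemma exists_koebeReal_eq {α : ℝ} (hα₁ : α < 0.05284) :
    ∃ r ∈ Ioo (0 : ℝ) (1 / 3), koebeReal α r = -koebeReal α (-1) := by
  have h0 : koebeReal α 0 < -koebeReal α (-1) := by
    rw [neg_koebeReal_neg_one, koebeReal, zero_mul]
    exact Real.exp_pos _
  have h1 : -koebeReal α (-1) < koebeReal α (1 / 3) := by
    have h := three_lt_exp_mul hα₁
    rw [mul_sub, Real.exp_sub, lt_div_iff₀ (Real.exp_pos _)] at h
    rw [neg_koebeReal_neg_one, koebeReal]
    linarith
  exact intermediate_value_Ioo (by norm_num) (continuous_koebeReal α).continuousOn ⟨h0, h1⟩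

lemma expFun_zero : expFun 0 = Complex.exp := by
  ext z
  simp [expFun]

/-- For `|z| ≤ r`: `M f |z| ≤ h |z| ≤ h r = -h (-1) ≤ d`. An admissible `ρ > r` would give `h ρ ≤ M
h ρ ≤ d ≤ |h (-1)| = h r`, against strict monotonicity. -/
lemma isBohrRadius_of_koebeReal_eq {α : ℝ} (hα : α ≤ 1) {h : ℂ → ℂ}
    (hh : IsKoebeFunction (expFun α) h) {r : ℝ} (hr : r ∈ Ioo (0 : ℝ) (1 / 3))
    (hroot : koebeReal α r = -koebeReal α (-1)) :
    IsBohrRadius (maMindaStarlike (expFun α)) r := by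
  have hmono := koebeReal_strictMonoOn hα
  refine ⟨⟨⟨hr.1, by linarith [hr.2]⟩, fun f hf z hz => ?_⟩, fun ρ ⟨hρ, hB⟩ => ?_⟩
  · rw [BohrInequality, enorm_add_tsum_eq_majorant hf.1, ← ofReal_norm]
    refine (majorant_le_koebeReal hα hf (norm_nonneg z) (hz.trans hr.2.le)).trans ?_
    refine le_trans (ENNReal.ofReal_le_ofReal ?_) (ofReal_le_infEDist_frontier hα hf)
    rw [← hroot]
    exact hmono.monotoneOn (norm_nonneg z) hr.1.le hz
  · by_contra! hlt
    have hρn : ‖(ρ : ℂ)‖ = ρ := by rw [Complex.norm_real, Real.norm_eq_abs, abs_of_pos hρ.1]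
    have hρd : (ρ : ℂ) ∈ disk := mem_disk.mpr (hρn.trans_lt hρ.2)
    have h1 := hB h hh.mem_maMindaStarlike ρ hρn.le
    rw [BohrInequality, enorm_add_tsum_eq_majorant hh.1] at h1
    have h2 := (enorm_le_majorant hh.1.1 hρd).trans (h1.trans
      (infEDist_le_edist_of_mem (mem_frontier_of_tendsto hh.1 hh.tendsto_neg)))
    rw [hh.ofReal (by rw [abs_of_pos hρ.1]; exact hρ.2), hh.1.2.2.1, edist_comm,
      edist_zero_right, ← ofReal_norm, ← ofReal_norm, Complex.norm_real, Complex.norm_real,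
      Real.norm_eq_abs, Real.norm_eq_abs, abs_of_pos (koebeReal_pos hρ.1),
      ← abs_neg (koebeReal α (-1)), ← hroot, abs_of_pos (koebeReal_pos hr.1),
      ENNReal.ofReal_le_ofReal_iff (koebeReal_pos hr.1).le] at h2
    exact absurd h2 (not_le.mpr (hmono hr.1.le hρ.1.le hlt))

end BohrStarlike

end

/-- `m` is the value `h(-1)`, understood as the limit of `h(-r)` as `r → 1⁻`. -/
theorem corollary2p4 (α : ℝ) (hα₀ : 0 ≤ α) (hα₁ : α < 0.05284) :
    (∃ h : ℂ → ℂ, BohrStarlike.IsKoebeFunction (BohrStarlike.expFun α) h) ∧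
    ∀ h : ℂ → ℂ, BohrStarlike.IsKoebeFunction (BohrStarlike.expFun α) h →
      ∃ (m : ℂ) (rf : ℝ),
        Tendsto (fun r : ℝ => h (-(r : ℂ))) (𝓝[<] 1) (𝓝 m) ∧
        IsLeast {r : ℝ | r ∈ Ioo (0 : ℝ) 1 ∧ h (r : ℂ) + m = 0} rf ∧
        rf < 1 / 3 ∧
        BohrStarlike.IsBohrRadius
          (BohrStarlike.maMindaStarlike (BohrStarlike.expFun α)) rf ∧
        (α = 0 → BohrStarlike.IsBohrRadius
          (BohrStarlike.maMindaStarlike Complex.exp) rf) := by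
  have hα : α < 1 := hα₁.trans (by norm_num)
  refine ⟨⟨_, BohrStarlike.isKoebeFunction_koebe hα₀ hα⟩, fun h hh => ?_⟩
  obtain ⟨r, hr, hroot⟩ := BohrStarlike.exists_koebeReal_eq hα₁
  have hB := BohrStarlike.isBohrRadius_of_koebeReal_eq hα.le hh hr hroot
  have hval : ∀ s ∈ Ioo (0 : ℝ) 1, h (s : ℂ) = (BohrStarlike.koebeReal α s : ℂ) := fun s hs =>
    hh.ofReal (by rw [abs_of_pos hs.1]; exact hs.2)
  have hr1 : r ∈ Ioo (0 : ℝ) 1 := ⟨hr.1, by linarith [hr.2]⟩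
  refine ⟨(BohrStarlike.koebeReal α (-1) : ℂ), r, hh.tendsto_neg,
    ⟨⟨hr1, ?_⟩, fun s ⟨hs, hs0⟩ => ?_⟩, hr.2, hB, ?_⟩
  · rw [hval r hr1, hroot]
    push_cast
    ring
  · rw [hval s hs] at hs0
    have hs1 : BohrStarlike.koebeReal α s = -BohrStarlike.koebeReal α (-1) :=
      eq_neg_of_add_eq_zero_left (by exact_mod_cast hs0)
    -- Strict monotonicity makes the root unique, hence the least one.
    exact ((BohrStarlike.koebeReal_strictMonoOn hα.le).injOn hr.1.le hs.1.le
      (hroot.trans hs1.symm)).le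
  · rintro rfl
    rwa [BohrStarlike.expFun_zero] at hB
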